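/- Let $\Gamma=(G,\sigma)$ be a signed graph of order $n$, that is, a finite simple graph $G$ with $n$ vertices together with a sign function $\sigma:E(G)\to\{+1,-1\}$, and suppose that every connected component of $G$ has at least two vertices. Let $i_-(\Gamma)$ be the number of negative eigenvalues, counted with multiplicity, of the adjacency matrix of $\Gamma$ (its $(u,v)$ entry is $\sigma(uv)$ if $uv\in E(G)$ and $0$ otherwise), let $p(\Gamma)$ be the number of vertices of degree $1$, and let $\theta(\Gamma)=|E(G)|-|V(G)|+c(G)$, where $c(G)$ is the number of connected components of $G$. A signed graph is called balanced if the product of the edge signs along each of its cycles is $+1$, and unbalanced otherwise. Then $$i_-(\Gamma)=\frac{n-p(\Gamma)}{2}-\theta(\Gamma)$$ if and only if $\Gamma$ is isomorphic, as a signed graph (by a graph isomorphism that preserves the edge signs), to a disjoint union $C_{n_1}^{\sigma}\cup C_{n_2}^{\sigma}\cup\cdots\cup C_{n_t}^{\sigma}$ of signed cycles, where $n_i\ge 3$ is the number of vertices of the $i$-th cycle, $n_1+n_2+\cdots+n_t=n$, and for every $i\in\{1,\ldots,t\}$: $n_i\equiv 0\pmod 4$ if $C_{n_i}^{\sigma}$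 is balanced, and $n_i\equiv 2\pmod 4$ if $C_{n_i}^{\sigma}$ is unbalanced. -/

import Mathlib

/-- A signed graph `Γ = (G, σ)` on the vertex set `V`: a simple graph together with a sign
`+1` or `-1` for every edge. A function on edges is given as a function of an
adjacent pair of vertices that does not depend on the order of the two ends. -/
structure SignedGraph (V : Type*) where
  /-- the underlying graph -/
  graph : SimpleGraph V
  /-- the sign of the edge `uv` -/
  sign : ∀ u v : V, graph.Adj u v → ℤˣ
  sign_comm : ∀ (u v : V) (h : graph.Adj u v), sign u v h = sign v u h.symm

namespace SignedGraph

open scoped Classical in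
/-- The adjacency matrix: the entry at `(u, v)` is the sign of the edge `uv`, and `0` if there
is no such edge. -/
noncomputable def adjMatrix {V : Type*} (Γ : SignedGraph V) : Matrix V V ℝ :=
  Matrix.of fun u v => if h : Γ.graph.Adj u v then ((Γ.sign u v h : ℤ) : ℝ) else 0

theorem isHermitian_adjMatrix {V : Type*} (Γ : SignedGraph V) : Γ.adjMatrix.IsHermitian := by
  ext u v
  by_cases h : Γ.graph.Adj u v
  · simp [adjMatrix, h, h.symm, Γ.sign_comm u v h]
  · have h' : ¬ Γ.graph.Adj v u := fun k => h k.symm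
    simp [adjMatrix, h, h']

open scoped Classical in
/-- The negative inertia index `i₋(Γ)`: the number of negative eigenvalues of the adjacency
matrix, counted with multiplicity. -/
noncomputable def negInertia {V : Type*} [Fintype V] (Γ : SignedGraph V) : ℕ :=
  Nat.card {i : V // Γ.isHermitian_adjMatrix.eigenvalues i < 0}

/-- The number `p(Γ)` of pendant vertices, i.e. of vertices with exactly one neighbour. -/
noncomputable def numPendant {V : Type*} (Γ : SignedGraph V) : ℕ :=
  {v : V | (Γ.graph.neighborSet v).ncard = 1}.ncard

/-- The cyclomatic number `θ(Γ) = |E| - |V| + c`, where `c` is the number of connected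
components. -/
noncomputable def cyclomatic {V : Type*} (Γ : SignedGraph V) : ℤ :=
  (Γ.graph.edgeSet.ncard : ℤ) - (Nat.card V : ℤ) + (Nat.card Γ.graph.ConnectedComponent : ℤ)

/-- The sign of a walk: the product of the signs of the edges it runs through. A cycle
runs through each of its edges exactly once. -/
def walkSign {V : Type*} (Γ : SignedGraph V) {u v : V} (w : Γ.graph.Walk u v) : ℤˣ :=
  (w.darts.map fun d => Γ.sign d.fst d.snd d.adj).prod

/-- A signed graph is balanced if all of its cycles are positive. -/
def Balanced {V : Type*} (Γ : SignedGraph V) : Prop :=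
  ∀ (v : V) (w : Γ.graph.Walk v v), w.IsCycle → Γ.walkSign w = 1

/-- An isomorphism of signed graphs: a bijection of the vertices that preserves adjacency,
non-adjacency and the signs of the edges. -/
structure Iso {V W : Type*} (Γ : SignedGraph V) (Δ : SignedGraph W) where
  /-- the isomorphism of the underlying graphs -/
  toGraphIso : Γ.graph ≃g Δ.graph
  sign_eq : ∀ (u v : V) (h : Γ.graph.Adj u v),
    Δ.sign (toGraphIso u) (toGraphIso v) (toGraphIso.map_rel_iff.2 h) = Γ.sign u v h

/-- The disjoint union of a family of signed graphs: `(i, u)` and `(j, v)` are adjacent if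
and only if `i = j` and `u`, `v` are adjacent in the `i`-th graph, and then the sign is the one
there. -/
def disjointUnion {ι : Type*} {W : ι → Type*} (Γ : ∀ i, SignedGraph (W i)) :
    SignedGraph (Σ i, W i) where
  graph :=
    { Adj := fun x y => ∃ h : x.1 = y.1, (Γ y.1).graph.Adj (h ▸ x.2) y.2
      symm := ⟨by
        rintro ⟨i, u⟩ ⟨j, v⟩ ⟨h, k⟩
        cases h
        exact ⟨rfl, k.symm⟩⟩
      loopless := ⟨by
        rintro ⟨i, u⟩ ⟨h, k⟩
        exact k.ne rfl⟩ }
  sign := fun x y h => (Γ y.1).sign (h.fst ▸ x.2) y.2 h.snd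
  sign_comm := by
    rintro ⟨i, u⟩ ⟨j, v⟩ ⟨h, k⟩
    cases h
    exact (Γ i).sign_comm u v k

/-- A signed graph on `Fin n` is a signed cycle `C_n^σ` if `n ≥ 3` and its underlying graph is
the cycle `0, 1, …, n - 1, 0`. -/
def IsSignedCycle {n : ℕ} (Γ : SignedGraph (Fin n)) : Prop :=
  3 ≤ n ∧ Γ.graph = SimpleGraph.cycleGraph n

end SignedGraph

/-!
Call `2 i₋ + 2 θ + p - n` the *excess* of a signed graph. It is additive over connected components,
so it suffices to treat a connected graph with at least two vertices, where we show that the excess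
is nonnegative, and positive unless the graph is a cycle. The proof is by induction on the number
of vertices. By Sylvester's law of inertia `i₋` is the negative index of the quadratic form
`x ↦ xᵀ A x`, so deleting a vertex does not increase it; deleting a pendant vertex `u` together with
its neighbour decreases it, since the isotropic vector `e_u` is orthogonal to the rest of the graph
without being in the radical. Deleting a vertex whose removal keeps the graph connected changes
`θ` and `p` in a way that depends only on its degree and the degrees of its neighbours, which
leaves the cycles as the only possible graphs of excess `0`.

The excess of a signed cycle of length `m` is `2 i₋ + 2 - m`. This is odd for odd `m`. For
`m = 2 q` the graph is bipartite, so its spectrum is symmetric and the excess is `2` minus the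
nullity. Multiplying each value of a kernel vector by the product of the edge signs up to its vertex
turns the kernel equations into `y (l + 2) = -y l`; going once around the cycle, a nonzero solution
closes up if and only if the sign of the cycle is `(-1) ^ q`.
-/

open Matrix

section Signature

variable {𝕜 M M' : Type*} [Field 𝕜] [LinearOrder 𝕜] [IsStrictOrderedRing 𝕜]
  [AddCommGroup M] [Module 𝕜 M] [FiniteDimensional 𝕜 M] [AddCommGroup M'] [Module 𝕜 M']
  {Q : QuadraticForm 𝕜 M} {Q' : QuadraticForm 𝕜 M'}

theorem finrank_le_sigNeg_of_forall_neg (f : M' →ₗ[𝕜] M) (hf : ∀ x ≠ 0, Q (f x) < 0) :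
    Module.finrank 𝕜 M' ≤ sigNeg Q := by
  have hinj : Function.Injective f := (injective_iff_map_eq_zero f).2 fun x hx => by
    by_contra hne
    simpa [hx] using hf x hne
  rw [← LinearMap.finrank_range_of_inj hinj]
  refine le_sigNeg_of_negDef Q ?_
  rintro ⟨_, x, rfl⟩ hne
  have hx : x ≠ 0 := fun h => hne (by simp [h])
  simpa using hf x hx

theorem exists_finrank_eq_sigNeg_forall_neg (Q : QuadraticForm 𝕜 M) :
    ∃ V : Submodule 𝕜 M, Module.finrank 𝕜 V = sigNeg Q ∧ ∀ x : V, x ≠ 0 → Q x < 0 := by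
  obtain ⟨V, hV, hneg⟩ := exists_finrank_eq_sigNeg_and_negDef Q
  exact ⟨V, hV, fun x hx => by simpa using hneg x hx⟩

theorem sigNeg_le_of_isometry [FiniteDimensional 𝕜 M'] (f : Q' →qᵢ Q) :
    sigNeg Q' ≤ sigNeg Q := by
  obtain ⟨V, hV, hneg⟩ := exists_finrank_eq_sigNeg_forall_neg Q'
  rw [← hV]
  refine finrank_le_sigNeg_of_forall_neg (f.toLinearMap ∘ₗ V.subtype) fun x hx => ?_
  simpa using hneg x hx

theorem sigNeg_lt_of_isometry_of_isotropic [FiniteDimensional 𝕜 M'] (f : Q' →qᵢ Q) {u v : M}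
    (hu : Q u = 0) (huf : ∀ x, QuadraticMap.polar Q u (f x) = 0)
    (huv : QuadraticMap.polar Q u v ≠ 0) : sigNeg Q' < sigNeg Q := by
  obtain ⟨V, hV, hneg⟩ := exists_finrank_eq_sigNeg_forall_neg Q'
  let g : V × 𝕜 →ₗ[𝕜] M := f.toLinearMap ∘ₗ V.subtype ∘ₗ LinearMap.fst 𝕜 V 𝕜
  let t : V × 𝕜 →ₗ[𝕜] 𝕜 := LinearMap.snd 𝕜 V 𝕜
  -- The coefficient of `u` that makes `Q (g z + t z • v + b z • u) = Q (g z) - t z ^ 2`.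
  let b : V × 𝕜 →ₗ[𝕜] 𝕜 :=
    -(QuadraticMap.polar Q u v)⁻¹ • ((1 + Q v) • t + Q.polarBilin.flip v ∘ₗ g)
  let F : V × 𝕜 →ₗ[𝕜] M := g + t.smulRight v + b.smulRight u
  have hb (z) : b z * QuadraticMap.polar Q u v =
      -((1 + Q v) * t z + QuadraticMap.polar Q (g z) v) := by
    simp only [b, LinearMap.smul_apply, LinearMap.add_apply, LinearMap.comp_apply,
      LinearMap.flip_apply, QuadraticMap.polarBilin_apply_apply, smul_eq_mul]
    field_simp
  have hF (z) : Q (F z) = Q' z.1 - t z ^ 2 := by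
    have hg : Q (g z) = Q' z.1 := f.map_app z.1
    have hug : QuadraticMap.polar Q (g z) u = 0 := by
      rw [QuadraticMap.polar_comm]; exact huf z.1
    simp only [F, LinearMap.add_apply, LinearMap.smulRight_apply, QuadraticMap.map_add Q,
      QuadraticMap.map_smul, QuadraticMap.polar_add_left, QuadraticMap.polar_smul_left,
      QuadraticMap.polar_smul_right, QuadraticMap.polar_comm Q v u, hu, hug, hg, smul_eq_mul]
    linear_combination t z * hb z
  have hrank := finrank_le_sigNeg_of_forall_neg F fun z hz => by
    rw [hF]
    by_cases h1 : z.1 = 0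
    · have h2 : t z ≠ 0 := fun h2 => hz (Prod.ext h1 h2)
      simpa [h1] using pow_pos (abs_pos.2 h2) 2
    · linarith [hneg z.1 h1, sq_nonneg (t z)]
  rw [Module.finrank_prod, hV, Module.finrank_self] at hrank
  exact hrank

theorem two_mul_sigNeg_add_finrank_radical (e : Q.Equivalent (-Q)) :
    2 * sigNeg Q + Module.finrank 𝕜 Q.radical = Module.finrank 𝕜 M := by
  have hpos : sigPos Q = sigNeg Q := e.sigPos_eq.trans sigPos_neg
  rw [← QuadraticForm.sigPos_add_sigNeg_add_radical (Q := Q), hpos, two_mul]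

end Signature

section MatrixForm

variable {R m n : Type*} [CommRing R] [Fintype m] [Fintype n]

theorem dotProduct_extend {f : m → n} (hf : Function.Injective f) (y : n → R) (x : m → R) :
    y ⬝ᵥ Function.extend f x 0 = (y ∘ f) ⬝ᵥ x :=
  (Fintype.sum_of_injective f hf _ _ (fun j hj => by
    simp [Function.extend_apply' _ _ _ fun ⟨i, hi⟩ => hj ⟨i, hi⟩])
    fun i => by simp [hf.extend_apply]).symm

variable [DecidableEq m] [DecidableEq n]

theorem toQuadraticForm'_apply (A : Matrix n n R) (x : n → R) :
    A.toQuadraticForm' x = x ⬝ᵥ A *ᵥ x := by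
  simp [toQuadraticForm', toLinearMap₂'_apply']

theorem polar_toQuadraticForm' {A : Matrix n n R} (hA : A.IsSymm) (x y : n → R) :
    QuadraticMap.polar A.toQuadraticForm' x y = 2 * (x ⬝ᵥ A *ᵥ y) := by
  have hcomm : y ⬝ᵥ A *ᵥ x = x ⬝ᵥ A *ᵥ y := by
    rw [dotProduct_mulVec, ← mulVec_transpose, hA.eq, dotProduct_comm]
  simp only [QuadraticMap.polar, toQuadraticForm'_apply, mulVec_add, dotProduct_add,
    add_dotProduct, hcomm]
  ring

theorem radical_toQuadraticForm' [NoZeroDivisors R] [NeZero (2 : R)] {A : Matrix n n R}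
    (hA : A.IsSymm) :
    A.toQuadraticForm'.radical = LinearMap.ker A.mulVecLin := by
  ext x
  have hpolar (y : n → R) :
      QuadraticMap.polar A.toQuadraticForm' x y = 2 * (A *ᵥ x ⬝ᵥ y) := by
    rw [polar_toQuadraticForm' hA, dotProduct_mulVec, ← mulVec_transpose, hA.eq]
  have hmem : x ∈ A.toQuadraticForm'.radical ↔
      A.toQuadraticForm' x = 0 ∧ ∀ y, QuadraticMap.polar A.toQuadraticForm' x y = 0 := by
    simp [QuadraticMap.radical, LinearMap.ext_iff, QuadraticMap.polarBilin]
  rw [hmem, LinearMap.mem_ker, mulVecLin_apply]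
  refine ⟨fun h => dotProduct_eq_zero _ fun y => ?_, fun h => ?_⟩
  · exact (mul_eq_zero_iff_left (NeZero.ne (2 : R))).1 (hpolar y ▸ h.2 y)
  · simp [hpolar, toQuadraticForm'_apply, h]

/-- Extension by zero along `f`, as an isometry from the form of a submatrix. -/
noncomputable def submatrixIsometry (A : Matrix n n R) {f : m → n} (hf : Function.Injective f) :
    (A.submatrix f f).toQuadraticForm' →qᵢ A.toQuadraticForm' where
  toLinearMap := Function.ExtendByZero.linearMap R f
  map_app' x := by
    have hmul : (A *ᵥ Function.extend f x 0) ∘ f = A.submatrix f f *ᵥ x :=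
      funext fun i => dotProduct_extend hf _ x
    change A.toQuadraticForm' (Function.extend f x 0) = _
    rw [toQuadraticForm'_apply, toQuadraticForm'_apply, dotProduct_comm, dotProduct_extend hf,
      hmul, dotProduct_comm]

end MatrixForm

theorem equivalent_weightedSumSquares_eigenvalues {n : Type*} [Fintype n] [DecidableEq n]
    {A : Matrix n n ℝ} (hA : A.IsHermitian) :
    A.toQuadraticForm'.Equivalent (QuadraticMap.weightedSumSquares ℝ hA.eigenvalues) := by
  have hdiag : (hA.eigenvectorUnitary : Matrix n n ℝ)ᵀ * A * hA.eigenvectorUnitary =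
      diagonal hA.eigenvalues := by
    simpa [Unitary.conjStarAlgAut_apply, star_eq_conjTranspose] using
      hA.conjStarAlgAut_star_eigenvectorUnitary
  refine QuadraticMap.Equivalent.symm ⟨UnitaryGroup.toLinearEquiv hA.eigenvectorUnitary,
    fun y => ?_⟩
  change A.toQuadraticForm' ((hA.eigenvectorUnitary : Matrix n n ℝ) *ᵥ y) = _
  rw [toQuadraticForm'_apply, dotProduct_comm, dotProduct_mulVec, ← mulVec_transpose, mulVec_mulVec,
    mulVec_mulVec, hdiag, dotProduct_comm]
  simp [dotProduct, mulVec_diagonal, QuadraticMap.weightedSumSquares_apply, mul_left_comm]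

section Pi

variable {𝕜 ι : Type*} [Field 𝕜] [LinearOrder 𝕜] [IsStrictOrderedRing 𝕜] [Fintype ι]

theorem sigNeg_pi {M : ι → Type*} [∀ i, AddCommGroup (M i)] [∀ i, Module 𝕜 (M i)]
    [∀ i, FiniteDimensional 𝕜 (M i)] (Q : ∀ i, QuadraticForm 𝕜 (M i)) :
    sigNeg (QuadraticMap.pi Q) = ∑ i, sigNeg (Q i) := by
  have : Invertible (2 : 𝕜) := invertibleOfNonzero (NeZero.ne _)
  choose w e using fun i => (Q i).equivalent_weightedSumSquares
  let W : (Σ i, Fin (Module.finrank 𝕜 (M i))) → 𝕜 := fun x => w x.1 x.2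
  have hW : (QuadraticMap.pi Q).Equivalent (QuadraticMap.weightedSumSquares 𝕜 W) := by
    refine (QuadraticMap.Equivalent.pi e).trans
      ⟨⟨(LinearEquiv.piCurry 𝕜 fun i (_ : Fin (Module.finrank 𝕜 (M i))) => 𝕜).symm, fun x => ?_⟩⟩
    simp [QuadraticMap.weightedSumSquares_apply, QuadraticMap.pi_apply, Fintype.sum_sigma, W,
      Sigma.uncurry]
  have hcard : {x | W x < 0}.ncard = ∑ i, {j | w i j < 0}.ncard := by
    classical
    simp only [Set.ncard_eq_toFinset_card', Set.toFinset_ofPred, Finset.card_filter,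
      Fintype.sum_sigma, W]
  rw [QuadraticForm.sigNeg_of_equiv_weightedSumSquares hW, hcard]
  exact Finset.sum_congr rfl fun i _ =>
    (QuadraticForm.sigNeg_of_equiv_weightedSumSquares (e i)).symm

end Pi

theorem equivalent_pi_blockDiagonal' {R ι : Type*} [CommRing R] [Fintype ι] [DecidableEq ι]
    {m : ι → Type*} [∀ i, Fintype (m i)] [∀ i, DecidableEq (m i)] (A : ∀ i, Matrix (m i) (m i) R) :
    (blockDiagonal' A).toQuadraticForm'.Equivalent
      (QuadraticMap.pi fun i => (A i).toQuadraticForm') := by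
  refine ⟨⟨LinearEquiv.piCurry R fun i (_ : m i) => R, fun x => ?_⟩⟩
  simp [QuadraticMap.pi_apply, toQuadraticForm'_apply, dotProduct, mulVec, Fintype.sum_sigma,
    Sigma.curry, Finset.mul_sum, blockDiagonal'_apply]

section Graph

variable {V : Type*}

theorem ncard_neighborSet (G : SimpleGraph V) (v : V) [Fintype (G.neighborSet v)] :
    (G.neighborSet v).ncard = G.degree v := by
  rw [Set.ncard_eq_toFinset_card', ← SimpleGraph.neighborFinset_def,
    SimpleGraph.card_neighborFinset_eq_degree]

theorem two_mul_ncard_edgeSet [Fintype V] (G : SimpleGraph V) :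
    2 * G.edgeSet.ncard = ∑ v, (G.neighborSet v).ncard := by
  classical
  rw [← SimpleGraph.coe_edgeFinset, Set.ncard_coe_finset, ← G.sum_degrees_eq_twice_card_edges]
  exact Finset.sum_congr rfl fun v _ => (ncard_neighborSet G v).symm

theorem card_connectedComponent_of_connected {G : SimpleGraph V} (hG : G.Connected) :
    Nat.card G.ConnectedComponent = 1 := by
  have := hG.preconnected.subsingleton_connectedComponent
  have := hG.nonempty.map G.connectedComponentMk
  exact Nat.card_unique

theorem reachable_induction {G : SimpleGraph V} {P : V → Prop}
    (hP : ∀ x y, G.Adj x y → P x → P y) {x y : V} (h : G.Reachable x y) (hx : P x) : P y := by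
  obtain ⟨p⟩ := h
  induction p with
  | nil => exact hx
  | cons hadj _ ih => exact ih (hP _ _ hadj hx)

theorem ncard_neighborSet_cycleGraph {n : ℕ} (hn : 3 ≤ n) (v : Fin n) :
    ((SimpleGraph.cycleGraph n).neighborSet v).ncard = 2 := by
  obtain ⟨k, rfl⟩ := Nat.exists_eq_add_of_le' hn
  rw [ncard_neighborSet, SimpleGraph.cycleGraph_degree_three_le]

theorem exists_iso_cycleGraph [Finite V] {G : SimpleGraph V} (hG : G.Connected)
    (h : ∀ v, (G.neighborSet v).ncard = 2) :
    ∃ m, 3 ≤ m ∧ Nonempty (SimpleGraph.cycleGraph m ≃g G) := by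
  obtain ⟨v⟩ := hG.nonempty
  have hcycles : G.IsCycles := fun v _ => h v
  obtain ⟨w, hw, -⟩ := hcycles.exists_cycle_toSubgraph_verts_eq_connectedComponentSupp
    (c := G.connectedComponentMk v) rfl (Set.nonempty_of_ncard_ne_zero (by simp [h]))
  have hlength := hw.three_le_length
  obtain ⟨f⟩ := (SimpleGraph.cycleGraph_isContained_iff hlength).2 ⟨v, w, hw, rfl⟩
  have himage (i) : f '' (SimpleGraph.cycleGraph w.length).neighborSet i =
      G.neighborSet (f i) := by
    refine Set.eq_of_subset_of_ncard_le (Set.image_subset_iff.2 fun j hj => f.toHom.map_adj hj) ?_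
    rw [h, Set.ncard_image_of_injective (f := f) _ f.injective,
      ncard_neighborSet_cycleGraph hlength]
  have hsurj : Function.Surjective f := fun y => by
    refine reachable_induction (P := (· ∈ Set.range f)) ?_
      (hG.preconnected (f ⟨0, by lia⟩) y) ⟨_, rfl⟩
    rintro _ y hy ⟨i, rfl⟩
    exact Set.image_subset_range _ _ ((himage i).ge hy)
  refine ⟨w.length, hlength, ⟨⟨.ofBijective f ⟨f.injective, hsurj⟩, fun {i j} => ?_⟩⟩⟩
  refine ⟨fun hij => ?_, fun hij => f.toHom.map_adj hij⟩
  exact (f.injective.mem_set_image).1 ((himage i).ge hij)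

end Graph

namespace SignedGraph

variable {V W : Type*}

/-- The pullback of a signed graph along a map of vertex sets. It is used for induced subgraphs
(`f` the inclusion) and for relabelling (`f` an equivalence). -/
def comap (f : W → V) (Γ : SignedGraph V) : SignedGraph W where
  graph := Γ.graph.comap f
  sign u v h := Γ.sign (f u) (f v) h
  sign_comm u v h := Γ.sign_comm (f u) (f v) h

/-- The vertex-deleted subgraph `Γ - v`. -/
abbrev delete (Γ : SignedGraph V) (v : V) : SignedGraph ({v}ᶜ : Set V) :=
  Γ.comap Subtype.val

theorem adjMatrix_comap (f : W → V) (Γ : SignedGraph V) :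
    (Γ.comap f).adjMatrix = Γ.adjMatrix.submatrix f f :=
  rfl

theorem adjMatrix_apply_ne_zero_iff {Γ : SignedGraph V} {u v : V} :
    Γ.adjMatrix u v ≠ 0 ↔ Γ.graph.Adj u v := by
  by_cases h : Γ.graph.Adj u v
  · simp [adjMatrix, h]
  · simp [adjMatrix, h]

section NegInertia

variable [Fintype V] [Fintype W] (Γ : SignedGraph V)

open scoped Classical in
theorem negInertia_eq_sigNeg : Γ.negInertia = sigNeg Γ.adjMatrix.toQuadraticForm' := by
  rw [QuadraticForm.sigNeg_of_equiv_weightedSumSquares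
    (equivalent_weightedSumSquares_eigenvalues Γ.isHermitian_adjMatrix)]
  rfl

theorem negInertia_comap_le {f : W → V} (hf : Function.Injective f) :
    (Γ.comap f).negInertia ≤ Γ.negInertia := by
  classical
  rw [negInertia_eq_sigNeg, negInertia_eq_sigNeg, adjMatrix_comap]
  exact sigNeg_le_of_isometry (submatrixIsometry Γ.adjMatrix hf)

theorem negInertia_comap_lt {f : W → V} (hf : Function.Injective f) {u v : V}
    (huf : ∀ w, ¬ Γ.graph.Adj u (f w)) (huv : Γ.graph.Adj u v) :
    (Γ.comap f).negInertia < Γ.negInertia := by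
  classical
  have hsymm : Γ.adjMatrix.IsSymm := Γ.isHermitian_adjMatrix
  have hrow (x : V → ℝ) : QuadraticMap.polar Γ.adjMatrix.toQuadraticForm' (Pi.single u 1) x =
      2 * (Γ.adjMatrix u ⬝ᵥ x) := by
    rw [polar_toQuadraticForm' hsymm, single_one_dotProduct]; rfl
  rw [negInertia_eq_sigNeg, negInertia_eq_sigNeg, adjMatrix_comap]
  refine sigNeg_lt_of_isometry_of_isotropic (submatrixIsometry Γ.adjMatrix hf)
    (u := Pi.single u 1) (v := Pi.single v 1) ?_ (fun x => ?_) ?_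
  · simp [toQuadraticForm'_apply, adjMatrix]
  · have hzero : Γ.adjMatrix u ∘ f = 0 := funext fun w => by
      simpa using mt adjMatrix_apply_ne_zero_iff.1 (huf w)
    change QuadraticMap.polar _ _ (Function.extend f x 0) = 0
    rw [hrow, dotProduct_extend hf, hzero, zero_dotProduct, mul_zero]
  · rw [hrow, dotProduct_single_one]
    simpa using adjMatrix_apply_ne_zero_iff.2 huv

end NegInertia

section DisjointUnion

variable {ι : Type*} {W : ι → Type*} (C : ∀ i, SignedGraph (W i))

theorem disjointUnion_adj_iff {i : ι} {u : W i} {y : Σ i, W i} :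
    (disjointUnion C).graph.Adj ⟨i, u⟩ y ↔ ∃ v, (C i).graph.Adj u v ∧ y = ⟨i, v⟩ := by
  constructor
  · obtain ⟨j, v⟩ := y
    rintro ⟨h, k⟩
    cases h
    exact ⟨v, k, rfl⟩
  · rintro ⟨v, h, rfl⟩
    exact ⟨rfl, h⟩

theorem neighborSet_disjointUnion (i : ι) (u : W i) :
    (disjointUnion C).graph.neighborSet ⟨i, u⟩ = Sigma.mk i '' (C i).graph.neighborSet u := by
  ext y
  simp [disjointUnion_adj_iff, eq_comm]

theorem ncard_neighborSet_disjointUnion (i : ι) (u : W i) :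
    ((disjointUnion C).graph.neighborSet ⟨i, u⟩).ncard = ((C i).graph.neighborSet u).ncard := by
  rw [neighborSet_disjointUnion, Set.ncard_image_of_injective _ sigma_mk_injective]

theorem card_connectedComponent_disjointUnion (hC : ∀ i, (C i).graph.Connected) :
    Nat.card (disjointUnion C).graph.ConnectedComponent = Nat.card ι := by
  let a (i : ι) : W i := (hC i).nonempty.some
  let incl (i : ι) : (C i).graph →g (disjointUnion C).graph :=
    ⟨Sigma.mk i, fun {u v} h => (disjointUnion_adj_iff C).2 ⟨v, h, rfl⟩⟩
  symm
  refine Nat.card_eq_of_bijective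
    (fun i => (disjointUnion C).graph.connectedComponentMk ⟨i, a i⟩) ⟨fun i j hij => ?_, ?_⟩
  · refine (reachable_induction (P := fun x => x.1 = i) ?_
      (SimpleGraph.ConnectedComponent.exact hij) rfl).symm
    rintro ⟨k, u⟩ y hadj rfl
    obtain ⟨v, -, rfl⟩ := (disjointUnion_adj_iff C).1 hadj
    rfl
  · rintro ⟨i, u⟩
    exact ⟨i, SimpleGraph.ConnectedComponent.sound (((hC i).preconnected (a i) u).map (incl i))⟩

theorem adjMatrix_disjointUnion [DecidableEq ι] :
    (disjointUnion C).adjMatrix = blockDiagonal' fun i => (C i).adjMatrix := by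
  ext ⟨i, u⟩ ⟨j, v⟩
  by_cases hij : i = j
  · subst hij
    by_cases huv : (C i).graph.Adj u v <;> simp [adjMatrix, disjointUnion, huv]
  · rw [blockDiagonal'_apply_ne _ _ _ hij]
    simp [adjMatrix, disjointUnion, hij]

variable [Fintype ι]

theorem negInertia_disjointUnion [∀ i, Fintype (W i)] :
    (disjointUnion C).negInertia = ∑ i, (C i).negInertia := by
  classical
  simp only [negInertia_eq_sigNeg]
  rw [← sigNeg_pi, adjMatrix_disjointUnion]
  convert (equivalent_pi_blockDiagonal' fun i => (C i).adjMatrix).sigNeg_eq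

theorem ncard_edgeSet_disjointUnion [∀ i, Finite (W i)] :
    (disjointUnion C).graph.edgeSet.ncard = ∑ i, (C i).graph.edgeSet.ncard := by
  have (i : ι) := Fintype.ofFinite (W i)
  refine Nat.eq_of_mul_eq_mul_left two_pos ?_
  simp only [Finset.mul_sum, two_mul_ncard_edgeSet, Fintype.sum_sigma,
    ncard_neighborSet_disjointUnion]

theorem numPendant_disjointUnion [∀ i, Finite (W i)] :
    (disjointUnion C).numPendant = ∑ i, (C i).numPendant := by
  classical
  have (i : ι) := Fintype.ofFinite (W i)
  simp only [numPendant, Set.ncard_eq_toFinset_card' {_v | _}, Set.toFinset_ofPred,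
    Finset.card_filter, Fintype.sum_sigma, ncard_neighborSet_disjointUnion]

end DisjointUnion

/-- Twice the defect of the bound `i₋(Γ) ≥ (n - p(Γ)) / 2 - θ(Γ)`. The factor `2` keeps it an
integer. -/
noncomputable def excess [Fintype V] (Γ : SignedGraph V) : ℤ :=
  2 * Γ.negInertia + 2 * Γ.cyclomatic + Γ.numPendant - Fintype.card V

theorem excess_eq_zero_iff [Fintype V] (Γ : SignedGraph V) :
    Γ.excess = 0 ↔ (Γ.negInertia : ℝ) =
      ((Fintype.card V : ℝ) - (Γ.numPendant : ℝ)) / 2 - (Γ.cyclomatic : ℝ) := by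
  rw [excess, ← @Int.cast_inj ℝ]
  push_cast
  constructor <;> intro h <;> linarith

/-- A bijection `e` of vertex sets, as an isomorphism onto `Γ` from its pullback along `e`. -/
def isoComap (Γ : SignedGraph V) (e : W ≃ V) : (Γ.comap e).Iso Γ where
  toGraphIso := SimpleGraph.Iso.comap e Γ.graph
  sign_eq _ _ _ := rfl

theorem Iso.comap_eq {Γ : SignedGraph V} {Δ : SignedGraph W} (e : Γ.Iso Δ) :
    Δ.comap e.toGraphIso = Γ := by
  obtain ⟨⟨e, he⟩, hs⟩ := e
  obtain ⟨G, s, hcomm⟩ := Γ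
  obtain rfl : Δ.graph.comap e = G := by ext u v; exact he
  have : (Δ.comap e).sign = s := by ext u v h; exact congrArg _ (hs u v h)
  subst this
  rfl

/-- The inverse of an isomorphism of signed graphs. -/
def Iso.symm {Γ : SignedGraph V} {Δ : SignedGraph W} (e : Γ.Iso Δ) : Δ.Iso Γ where
  toGraphIso := e.toGraphIso.symm
  sign_eq u v h := by
    rw [← e.sign_eq]
    congr! 1 <;> simp

theorem Iso.negInertia_le [Fintype V] [Fintype W] {Γ : SignedGraph V} {Δ : SignedGraph W}
    (e : Γ.Iso Δ) : Γ.negInertia ≤ Δ.negInertia := by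
  rw [← e.comap_eq]
  exact Δ.negInertia_comap_le e.toGraphIso.injective

theorem Iso.numPendant_eq {Γ : SignedGraph V} {Δ : SignedGraph W} (e : Γ.Iso Δ) :
    Γ.numPendant = Δ.numPendant := by
  have hN (v : V) : (Δ.graph.neighborSet (e.toGraphIso v)).ncard =
      (Γ.graph.neighborSet v).ncard := (Nat.card_congr (e.toGraphIso.mapNeighborSet v)).symm
  rw [numPendant, numPendant, ← Set.ncard_preimage_of_injective_subset_range
    e.toGraphIso.injective (by simp [e.toGraphIso.surjective.range_eq])]
  simp only [Set.preimage_ofPred_eq, hN]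

theorem Iso.cyclomatic_eq {Γ : SignedGraph V} {Δ : SignedGraph W} (e : Γ.Iso Δ) :
    Γ.cyclomatic = Δ.cyclomatic := by
  rw [cyclomatic, cyclomatic, Nat.card_congr e.toGraphIso.toEquiv,
    Nat.card_congr e.toGraphIso.connectedComponentEquiv, ← Nat.card_coe_set_eq,
    ← Nat.card_coe_set_eq, Nat.card_congr e.toGraphIso.mapEdgeSet]

theorem Iso.excess_eq [Fintype V] [Fintype W] {Γ : SignedGraph V} {Δ : SignedGraph W}
    (e : Γ.Iso Δ) : Γ.excess = Δ.excess := by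
  rw [excess, excess, e.negInertia_le.antisymm e.symm.negInertia_le, e.cyclomatic_eq,
    e.numPendant_eq, Fintype.card_congr e.toGraphIso.toEquiv]

theorem excess_disjointUnion {ι : Type*} [Fintype ι] {W : ι → Type*} [∀ i, Fintype (W i)]
    (C : ∀ i, SignedGraph (W i)) (hC : ∀ i, (C i).graph.Connected) :
    (disjointUnion C).excess = ∑ i, (C i).excess := by
  simp only [excess, cyclomatic, negInertia_disjointUnion, numPendant_disjointUnion,
    ncard_edgeSet_disjointUnion, card_connectedComponent_disjointUnion C hC,
    card_connectedComponent_of_connected (hC _), Nat.card_eq_fintype_card, Fintype.card_sigma,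
    Finset.sum_add_distrib, Finset.sum_sub_distrib, ← Finset.mul_sum]
  simp

/-- The isomorphism of a signed graph with the disjoint union of its components. -/
noncomputable def isoDisjointUnion (Γ : SignedGraph V) :
    (disjointUnion fun c : Γ.graph.ConnectedComponent =>
      Γ.comap (Subtype.val : c.supp → V)).Iso Γ where
  toGraphIso :=
    { toEquiv := Equiv.sigmaFiberEquiv Γ.graph.connectedComponentMk
      map_rel_iff' := by
        rintro ⟨c, u⟩ ⟨d, v⟩
        constructor
        · intro h
          obtain rfl : c = d :=
            (u.2.symm.trans (SimpleGraph.ConnectedComponent.sound h.reachable)).trans v.2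
          exact ⟨rfl, h⟩
        · rintro ⟨h, hadj⟩
          cases h
          exact hadj }
  sign_eq := by
    rintro ⟨c, u⟩ ⟨_, v⟩ ⟨h, hadj⟩
    cases h
    rfl

section Deletion

open scoped Classical

-- Without this instance, the one found for a twice deleted graph differs from the one a lemma about
-- a single deletion specializes to.
noncomputable local instance fintypeComplSingleton [Finite V] (v : V) :
    Fintype ({v}ᶜ : Set V) :=
  Fintype.ofFinite _

variable [Fintype V] {Γ : SignedGraph V} {u v : V}

theorem numPendant_eq_card (Γ : SignedGraph V) :
    Γ.numPendant = Finset.card {v | Γ.graph.degree v = 1} := by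
  simp only [numPendant, Set.ncard_eq_toFinset_card' {_v | _}, Set.toFinset_ofPred,
    ncard_neighborSet]

theorem degree_delete (Γ : SignedGraph V) (v : V) (w : ({v}ᶜ : Set V)) :
    (Γ.delete v).graph.degree w + (if Γ.graph.Adj v w then 1 else 0) = Γ.graph.degree w := by
  have himage : ((Γ.delete v).graph.neighborFinset w).map ⟨Subtype.val, Subtype.val_injective⟩ =
      (Γ.graph.neighborFinset w).erase v := by
    ext x
    simp [comap, and_comm]
  rw [← SimpleGraph.card_neighborFinset_eq_degree, ← SimpleGraph.card_neighborFinset_eq_degree,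
    ← Finset.card_map ⟨Subtype.val, Subtype.val_injective⟩, himage, Finset.card_erase_eq_ite]
  by_cases h : Γ.graph.Adj v w
  · have hmem : v ∈ Γ.graph.neighborFinset w := by simpa using h.symm
    simpa [h, hmem] using Nat.sub_add_cancel (Finset.card_pos.2 ⟨v, hmem⟩)
  · simp [h, Γ.graph.adj_comm w v]

/-- The number of neighbours of `v` of degree `k`. -/
noncomputable def nbrsOfDegree (Γ : SignedGraph V) (v : V) (k : ℕ) : ℕ :=
  Finset.card {w ∈ Γ.graph.neighborFinset v | Γ.graph.degree w = k}

theorem numPendant_delete (Γ : SignedGraph V) (v : V) :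
    (Γ.delete v).numPendant + Γ.nbrsOfDegree v 1 + (if Γ.graph.degree v = 1 then 1 else 0) =
      Γ.numPendant + Γ.nbrsOfDegree v 2 := by
  have hsplit (f : V → ℕ) : ∑ w, f w = f v + ∑ w : ({v}ᶜ : Set V), f w := by
    rw [Fintype.sum_eq_add_sum_compl v, Finset.sum_subtype]
    simp
  have hnbrs (k) : Γ.nbrsOfDegree v k = ∑ w : ({v}ᶜ : Set V),
      if Γ.graph.Adj v w ∧ Γ.graph.degree w = k then 1 else 0 := by
    rw [nbrsOfDegree, SimpleGraph.neighborFinset_eq_filter, Finset.filter_filter,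
      Finset.card_filter, hsplit]
    simp
  rw [hnbrs, hnbrs, numPendant_eq_card, numPendant_eq_card, Finset.card_filter,
    Finset.card_filter, hsplit, add_comm _ (ite _ _ _), add_assoc, ← Finset.sum_add_distrib,
    ← Finset.sum_add_distrib]
  refine congrArg _ (Finset.sum_congr rfl fun w _ => ?_)
  have hdeg := Γ.degree_delete v w
  split_ifs at hdeg ⊢ <;> grind

theorem ncard_edgeSet_delete (Γ : SignedGraph V) (v : V) :
    (Γ.delete v).graph.edgeSet.ncard + Γ.graph.degree v = Γ.graph.edgeSet.ncard := by
  have hcard : (Γ.graph.induce {v}ᶜ).edgeSet.ncard =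
      Γ.graph.edgeFinset.card - Γ.graph.degree v := by
    rw [← SimpleGraph.card_edgeFinset_deleteIncidenceSet,
      ← SimpleGraph.card_edgeFinset_induce_compl_singleton, ← SimpleGraph.coe_edgeFinset,
      Set.ncard_coe_finset]
    congr!
  rw [← SimpleGraph.coe_edgeFinset Γ.graph, Set.ncard_coe_finset]
  exact hcard ▸ Nat.sub_add_cancel (Γ.graph.degree_le_card_edgeFinset v)

theorem excess_of_connected (h : Γ.graph.Connected) : Γ.excess =
    2 * Γ.negInertia + 2 * Γ.graph.edgeSet.ncard + 2 + Γ.numPendant - 3 * Fintype.card V := by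
  rw [excess, cyclomatic, card_connectedComponent_of_connected h, Nat.card_eq_fintype_card]
  push_cast
  ring

theorem excess_add_excess_delete (h : Γ.graph.Connected) (hv : (Γ.delete v).graph.Connected) :
    Γ.excess + 2 * (Γ.delete v).negInertia + Γ.nbrsOfDegree v 2 + 3 =
      (Γ.delete v).excess + 2 * Γ.negInertia + 2 * Γ.graph.degree v + Γ.nbrsOfDegree v 1 +
        (if Γ.graph.degree v = 1 then 1 else 0) := by
  have hE := Γ.ncard_edgeSet_delete v
  have hp := Γ.numPendant_delete v
  have hn : Fintype.card ({v}ᶜ : Set V) + 1 = Fintype.card V := by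
    rw [Fintype.card_compl_set, Set.card_singleton, Nat.sub_add_cancel (Fintype.card_pos_iff.2 ⟨v⟩)]
  rw [excess_of_connected h, excess_of_connected hv]
  split_ifs at hp ⊢ <;> omega

theorem negInertia_delete_le (Γ : SignedGraph V) (v : V) : (Γ.delete v).negInertia ≤ Γ.negInertia :=
  Γ.negInertia_comap_le Subtype.val_injective

theorem negInertia_delete_delete_lt (huv : Γ.graph.Adj u v) (hu : Γ.graph.degree u = 1) :
    ((Γ.delete u).delete ⟨v, huv.ne'⟩).negInertia < Γ.negInertia := by
  obtain ⟨v', -, hv'⟩ := Γ.graph.degree_eq_one_iff_existsUnique_adj.1 hu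
  obtain rfl := hv' v huv
  refine Γ.negInertia_comap_lt (f := fun w : ({⟨v, huv.ne'⟩}ᶜ : Set ({u}ᶜ : Set V)) => w.1.1)
    (Subtype.val_injective.comp Subtype.val_injective) (fun w hw => ?_) huv
  exact w.2 (Subtype.ext (hv' _ hw))

theorem connected_delete_of_adj (hv : (Γ.delete v).graph.Connected) (huv : Γ.graph.Adj u v)
    (hdegu : Γ.graph.degree u = 2) (hdegv : Γ.graph.degree v = 2) :
    (Γ.delete u).graph.Connected := by
  have hpendant : (Γ.delete v).graph.degree ⟨u, huv.ne⟩ = 1 := by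
    simpa [huv.symm, hdegu] using Γ.degree_delete v ⟨u, huv.ne⟩
  have hconn := hv.induce_compl_singleton_of_degree_eq_one hpendant
  let incl : ((Γ.delete v).delete ⟨u, huv.ne⟩).graph →g (Γ.delete u).graph :=
    ⟨fun x => ⟨x.1.1, fun hx => x.2 (Subtype.ext hx)⟩, id⟩
  obtain ⟨w, hw, hwu⟩ : ∃ w ∈ Γ.graph.neighborFinset v, w ≠ u :=
    Finset.exists_mem_ne (by simp [hdegv]) u
  rw [SimpleGraph.mem_neighborFinset] at hw
  let w' : ({⟨u, huv.ne⟩}ᶜ : Set ({v}ᶜ : Set V)) :=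
    ⟨⟨w, hw.ne'⟩, fun hx => hwu (congrArg Subtype.val hx)⟩
  refine (SimpleGraph.connected_iff_exists_forall_reachable _).2 ⟨incl w', fun x => ?_⟩
  by_cases hx : x.1 = v
  · refine SimpleGraph.Adj.reachable ?_
    change Γ.graph.Adj w x
    rw [hx]
    exact hw.symm
  · exact (hconn.preconnected w' ⟨⟨x, hx⟩, fun h => x.2 (congrArg Subtype.val h)⟩).map incl

theorem connected_delete_dichotomy [Nontrivial V] (h : Γ.graph.Connected) :
    (∀ v, Γ.graph.degree v = 2 ∧ (Γ.delete v).graph.Connected) ∨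
      ∃ v, (Γ.delete v).graph.Connected ∧
        (Γ.graph.degree v ≠ 2 ∨ ∃ w, Γ.graph.Adj v w ∧ Γ.graph.degree w ≠ 2) := by
  by_contra! hcon
  obtain ⟨⟨y, hy⟩, hcon⟩ := hcon
  obtain ⟨v, hv⟩ := h.exists_connected_induce_compl_singleton_of_finite_nontrivial
  have hall : (Γ.delete y).graph.Connected :=
    reachable_induction (P := fun x => (Γ.delete x).graph.Connected)
      (fun x z hxz hx => connected_delete_of_adj hx hxz.symm ((hcon x hx).2 z hxz) (hcon x hx).1)
      (h.preconnected v y) hv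
  exact hy (hcon y hall).1 hall

theorem nbrsOfDegree_of_degree_eq_one (huv : Γ.graph.Adj u v) (hu : Γ.graph.degree u = 1) (k : ℕ) :
    Γ.nbrsOfDegree u k = if Γ.graph.degree v = k then 1 else 0 := by
  obtain ⟨w, hw⟩ := Finset.card_eq_one.1 hu
  obtain rfl : v = w := by simpa [hw] using (Γ.graph.mem_neighborFinset u v).2 huv
  rw [nbrsOfDegree, hw, Finset.filter_singleton]
  split_ifs <;> rfl

theorem excess_of_degree_eq_one (h : Γ.graph.Connected) (huv : Γ.graph.Adj u v)
    (hu : Γ.graph.degree u = 1) :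
    Γ.excess + 2 * (Γ.delete u).negInertia + (if Γ.graph.degree v = 2 then 1 else 0) =
      (Γ.delete u).excess + 2 * Γ.negInertia + (if Γ.graph.degree v = 1 then 1 else 0) := by
  have hrec := excess_add_excess_delete h (h.induce_compl_singleton_of_degree_eq_one hu)
  rw [nbrsOfDegree_of_degree_eq_one huv hu, nbrsOfDegree_of_degree_eq_one huv hu, hu] at hrec
  split_ifs at hrec ⊢ <;> omega

theorem two_mul_negInertia_sub_card_le_excess (h : Γ.graph.Connected) :
    2 * (Γ.negInertia : ℤ) - Fintype.card V ≤ Γ.excess := by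
  have hE := h.card_vert_le_card_edgeSet_add_one
  rw [Nat.card_eq_fintype_card, Nat.card_coe_set_eq] at hE
  rw [excess_of_connected h]
  omega

/-- The bound on the excess of a connected signed graph with at least two vertices, in the form in
which it is proved by induction on the number of vertices: equality requires all degrees to be
`2`. -/
def ExcessBound (Γ : SignedGraph V) : Prop :=
  Γ.graph.Connected → Nontrivial V →
    0 ≤ Γ.excess ∧ ((∃ v, Γ.graph.degree v ≠ 2) → 1 ≤ Γ.excess)

theorem two_mul_negInertia_le_of_degree_eq_one (h : Γ.graph.Connected) (hu : Γ.graph.degree u = 1)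
    (ih : (Γ.delete u).ExcessBound) :
    2 * (Γ.negInertia : ℤ) ≤ Γ.excess + 2 * (Γ.delete u).negInertia := by
  obtain ⟨v, huv, -⟩ := Γ.graph.degree_eq_one_iff_existsUnique_adj.1 hu
  have hconn : (Γ.delete u).graph.Connected := h.induce_compl_singleton_of_degree_eq_one hu
  have hrec := excess_of_degree_eq_one h huv hu
  have hdeg : (Γ.delete u).graph.degree ⟨v, huv.ne'⟩ + 1 = Γ.graph.degree v := by
    simpa [huv] using Γ.degree_delete u ⟨v, huv.ne'⟩
  rcases subsingleton_or_nontrivial ({u}ᶜ : Set V) with hsub | hnontriv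
  · have hdegv : Γ.graph.degree v = 1 := by
      rw [← hdeg, SimpleGraph.degree_eq_zero_of_subsingleton]
    have hcard := Fintype.card_le_one_iff_subsingleton.2 hsub
    have hle := two_mul_negInertia_sub_card_le_excess hconn
    rw [hdegv] at hrec
    norm_num at hrec
    omega
  · obtain ⟨hnonneg, hpos⟩ := ih hconn hnontriv
    by_cases hv : Γ.graph.degree v = 2
    · have := hpos ⟨⟨v, huv.ne'⟩, by omega⟩
      rw [hv] at hrec
      norm_num at hrec
      omega
    · rw [if_neg hv] at hrec
      split_ifs at hrec <;> omega

theorem nbrsOfDegree_le_degree (Γ : SignedGraph V) (v : V) (k : ℕ) :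
    Γ.nbrsOfDegree v k ≤ Γ.graph.degree v :=
  Finset.card_filter_le _ _

theorem nbrsOfDegree_lt_degree {k : ℕ} (huv : Γ.graph.Adj u v) (hk : Γ.graph.degree v ≠ k) :
    Γ.nbrsOfDegree u k < Γ.graph.degree u :=
  Finset.card_lt_card (Finset.filter_ssubset.2 ⟨v, by simpa using huv, hk⟩)

theorem nontrivial_compl_singleton (hv : 2 ≤ Γ.graph.degree v) : Nontrivial ({v}ᶜ : Set V) := by
  have := Γ.graph.degree_lt_card_verts v
  rw [← Fintype.one_lt_card_iff_nontrivial, Fintype.card_compl_set, Set.card_singleton]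
  omega

theorem min_nbrsOfDegree_two_le_excess_delete (hconn : (Γ.delete v).graph.Connected)
    (hv : 2 ≤ Γ.graph.degree v) (ih : (Γ.delete v).ExcessBound) :
    min (Γ.nbrsOfDegree v 2 : ℤ) 1 ≤ (Γ.delete v).excess := by
  obtain ⟨hnonneg, hpos⟩ := ih hconn (nontrivial_compl_singleton hv)
  rcases Nat.eq_zero_or_pos (Γ.nbrsOfDegree v 2) with hzero | hnbr
  · simpa [hzero] using hnonneg
  · obtain ⟨w, hw⟩ := Finset.card_pos.1 hnbr
    obtain ⟨hvw, hdegw⟩ := Finset.mem_filter.1 hw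
    rw [SimpleGraph.mem_neighborFinset] at hvw
    have hpendant : (Γ.delete v).graph.degree ⟨w, hvw.ne'⟩ = 1 := by
      simpa [hvw, hdegw] using Γ.degree_delete v ⟨w, hvw.ne'⟩
    exact (min_le_right _ _).trans (hpos ⟨⟨w, hvw.ne'⟩, by omega⟩)

theorem two_mul_negInertia_le_of_two_le_degree (h : Γ.graph.Connected)
    (hconn : (Γ.delete v).graph.Connected) (hv : 2 ≤ Γ.graph.degree v)
    (ih : (Γ.delete v).ExcessBound) :
    2 * (Γ.negInertia : ℤ) + 2 * Γ.graph.degree v + min (Γ.nbrsOfDegree v 2 : ℤ) 1 ≤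
      Γ.excess + 2 * (Γ.delete v).negInertia + Γ.nbrsOfDegree v 2 + 3 := by
  have hrec := excess_add_excess_delete h hconn
  have hmin := min_nbrsOfDegree_two_le_excess_delete hconn hv ih
  split_ifs at hrec <;> omega

theorem one_le_excess_of_degree_eq_one (h : Γ.graph.Connected) (huv : Γ.graph.Adj u v)
    (hu : Γ.graph.degree u = 1) (ih : (Γ.delete u).ExcessBound)
    (ih' : ((Γ.delete u).delete ⟨v, huv.ne'⟩).ExcessBound) : 1 ≤ Γ.excess := by
  have hconn : (Γ.delete u).graph.Connected := h.induce_compl_singleton_of_degree_eq_one hu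
  have hrec := excess_of_degree_eq_one h huv hu
  have hlt := negInertia_delete_delete_lt huv hu
  have hdeg : (Γ.delete u).graph.degree ⟨v, huv.ne'⟩ + 1 = Γ.graph.degree v := by
    simpa [huv] using Γ.degree_delete u ⟨v, huv.ne'⟩
  rcases subsingleton_or_nontrivial ({u}ᶜ : Set V) with hsub | hnontriv
  · have hdegv : Γ.graph.degree v = 1 := by
      rw [← hdeg, SimpleGraph.degree_eq_zero_of_subsingleton]
    have hcard := Fintype.card_le_one_iff_subsingleton.2 hsub
    have hle := two_mul_negInertia_sub_card_le_excess hconn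
    split_ifs at hrec <;> omega
  by_cases hdegv : Γ.graph.degree v = 2
  · have hdegv' : (Γ.delete u).graph.degree ⟨v, huv.ne'⟩ = 1 := by omega
    have hle := two_mul_negInertia_le_of_degree_eq_one hconn hdegv' ih'
    split_ifs at hrec <;> omega
  rcases connected_delete_dichotomy hconn with hreg | ⟨w, -, hw⟩
  · obtain ⟨hdegv', hconn'⟩ := hreg ⟨v, huv.ne'⟩
    have hle := two_mul_negInertia_le_of_two_le_degree hconn hconn' hdegv'.ge ih'
    have hnbrs := (Γ.delete u).nbrsOfDegree_le_degree ⟨v, huv.ne'⟩ 2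
    split_ifs at hrec <;> omega
  · have hpos := (ih hconn hnontriv).2 (hw.elim (⟨_, ·⟩) fun ⟨x, _, hx⟩ => ⟨x, hx⟩)
    have hle := Γ.negInertia_delete_le u
    split_ifs at hrec <;> omega

theorem excess_bound_of_forall_two_le_degree (h : Γ.graph.Connected) [Nontrivial V]
    (hdeg : ∀ w, 2 ≤ Γ.graph.degree w) (ih : ∀ v, (Γ.delete v).ExcessBound) :
    0 ≤ Γ.excess ∧ ((∃ v, Γ.graph.degree v ≠ 2) → 1 ≤ Γ.excess) := by
  have hle {v : V} (hv : (Γ.delete v).graph.Connected) :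
      2 * (Γ.graph.degree v : ℤ) + min (Γ.nbrsOfDegree v 2 : ℤ) 1 ≤
        Γ.excess + Γ.nbrsOfDegree v 2 + 3 := by
    have := two_mul_negInertia_le_of_two_le_degree h hv (hdeg v) (ih v)
    have := Γ.negInertia_delete_le v
    omega
  rcases connected_delete_dichotomy h with hreg | ⟨v, hv, hv'⟩
  · obtain ⟨v⟩ := h.nonempty
    have := hle (hreg v).2
    have := Γ.nbrsOfDegree_le_degree v 2
    have := hdeg v
    exact ⟨by omega, fun ⟨w, hw⟩ => absurd (hreg w).1 hw⟩
  · have := hle hv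
    have hdegv := hdeg v
    have hpos : 1 ≤ Γ.excess := by
      have hnbrs := Γ.nbrsOfDegree_le_degree v 2
      rcases hv' with hne | ⟨w, hvw, hw⟩
      · omega
      · have := nbrsOfDegree_lt_degree hvw hw
        omega
    exact ⟨by omega, fun _ => hpos⟩

theorem excessBound (Γ : SignedGraph V) : Γ.ExcessBound := by
  induction hn : Fintype.card V using Nat.strong_induction_on generalizing V with
  | _ n ih =>
    intro h _
    have ih' (v : V) : (Γ.delete v).ExcessBound :=
      ih _ (hn ▸ Fintype.card_subtype_lt (x := v) (by simp)) _ rfl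
    by_cases hu : ∃ u, Γ.graph.degree u = 1
    · obtain ⟨u, hu⟩ := hu
      obtain ⟨v, huv, -⟩ := Γ.graph.degree_eq_one_iff_existsUnique_adj.1 hu
      have hpos : 1 ≤ Γ.excess := one_le_excess_of_degree_eq_one h huv hu (ih' u)
        (ih _ (hn ▸ (Fintype.card_subtype_lt (x := ⟨v, huv.ne'⟩) (by simp)).trans
          (Fintype.card_subtype_lt (x := u) (by simp))) _ rfl)
      exact ⟨by omega, fun _ => hpos⟩
    · refine excess_bound_of_forall_two_le_degree h (fun w => ?_) ih'
      have := h.preconnected.degree_pos_of_nontrivial w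
      grind

end Deletion

theorem equivalent_neg_of_coloring [Fintype V] [DecidableEq V] {Γ : SignedGraph V}
    (c : Γ.graph.Coloring Bool) :
    Γ.adjMatrix.toQuadraticForm'.Equivalent (-Γ.adjMatrix.toQuadraticForm') := by
  let flip : V → ℝ := fun v => if c v then 1 else -1
  have hflip (v) : flip v * flip v = 1 := by simp only [flip]; split_ifs <;> norm_num
  have hentry (u v) : flip u * Γ.adjMatrix u v * flip v = -Γ.adjMatrix u v := by
    by_cases h : Γ.adjMatrix u v = 0
    · simp [h]
    · have hne : c u ≠ c v := c.valid (Γ.adjMatrix_apply_ne_zero_iff.1 h)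
      cases hu : c u <;> cases hv : c v <;> simp_all [flip]
  refine ⟨⟨LinearEquiv.ofInvolutive (diagonal flip).mulVecLin fun x => ?_, fun x => ?_⟩⟩
  · simp [mulVec_mulVec, hflip]
  · have hmul : diagonal flip * Γ.adjMatrix * diagonal flip = -Γ.adjMatrix := by
      ext u v
      rw [mul_diagonal, diagonal_mul, hentry, neg_apply]
    change -Γ.adjMatrix.toQuadraticForm' (diagonal flip *ᵥ x) = _
    rw [toQuadraticForm'_apply, toQuadraticForm'_apply, dotProduct_comm, dotProduct_mulVec,
      ← mulVec_transpose, mulVec_mulVec, mulVec_mulVec, diagonal_transpose, hmul, neg_mulVec,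
      neg_dotProduct, neg_neg, dotProduct_comm]

theorem two_mul_negInertia_add_finrank_ker [Fintype V] {Γ : SignedGraph V}
    (c : Γ.graph.Coloring Bool) :
    2 * Γ.negInertia + Module.finrank ℝ (LinearMap.ker Γ.adjMatrix.mulVecLin) =
      Fintype.card V := by
  classical
  have hsymm : Γ.adjMatrix.IsSymm := Γ.isHermitian_adjMatrix
  rw [negInertia_eq_sigNeg, ← radical_toQuadraticForm' hsymm,
    two_mul_sigNeg_add_finrank_radical (equivalent_neg_of_coloring c),
    Module.finrank_fintype_fun_eq_card]

section Walk

variable {Γ : SignedGraph V} {u v : V}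

theorem walkSign_eq_prod_range (w : Γ.graph.Walk u v) (s : ℕ → ℤˣ)
    (hs : ∀ i (hi : i < w.length), Γ.sign _ _ (w.adj_getVert_succ hi) = s i) :
    Γ.walkSign w = ∏ i ∈ Finset.range w.length, s i := by
  induction w generalizing s with
  | nil => simp [walkSign]
  | cons h w ih =>
    have htail : Γ.walkSign w = ∏ i ∈ Finset.range w.length, s (i + 1) :=
      ih (fun i => s (i + 1)) fun i hi => hs (i + 1) (Nat.succ_lt_succ hi)
    have hhead : Γ.sign _ _ h = s 0 := by simpa using hs 0 (Nat.succ_pos _)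
    rw [SimpleGraph.Walk.length_cons, Finset.prod_range_succ', ← htail, ← hhead, mul_comm]
    simp [walkSign]

theorem walkSign_eq_of_potential {φ : V → ℤˣ} (hφ : ∀ u v h, Γ.sign u v h = φ u * φ v)
    (w : Γ.graph.Walk u v) : Γ.walkSign w = φ u * φ v := by
  induction w with
  | nil => simp [walkSign]
  | @cons a b c h w ih =>
    have hcons : Γ.walkSign (.cons h w) = Γ.sign a b h * Γ.walkSign w := by simp [walkSign]
    rw [hcons, ih, hφ, mul_assoc, ← mul_assoc (φ b), Int.units_mul_self, one_mul]

end Walk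

theorem excess_of_forall_ncard_neighborSet_eq_two [Fintype V] {Γ : SignedGraph V}
    (h : Γ.graph.Connected) (htwo : ∀ v, (Γ.graph.neighborSet v).ncard = 2) :
    Γ.excess = 2 * Γ.negInertia + 2 - Fintype.card V := by
  have hedge := two_mul_ncard_edgeSet Γ.graph
  have hpendant : Γ.numPendant = 0 := by simp [numPendant, htwo]
  simp only [htwo, Finset.sum_const, Finset.card_univ, smul_eq_mul] at hedge
  rw [excess_of_connected h, hpendant]
  lia

theorem IsSignedCycle.connected {n : ℕ} {C : SignedGraph (Fin n)} (hC : C.IsSignedCycle) :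
    C.graph.Connected := by
  obtain ⟨k, rfl⟩ := Nat.exists_eq_add_of_le' hC.1
  rw [hC.2]
  exact SimpleGraph.cycleGraph_connected

theorem IsSignedCycle.nontrivial {n : ℕ} {C : SignedGraph (Fin n)} (hC : C.IsSignedCycle) :
    Nontrivial (Fin n) :=
  Fin.nontrivial_iff_two_le.2 ((Nat.le_succ 2).trans hC.1)

theorem IsSignedCycle.excess_eq {n : ℕ} {C : SignedGraph (Fin n)} (hC : C.IsSignedCycle) :
    C.excess = 2 * C.negInertia + 2 - n := by
  rw [excess_of_forall_ncard_neighborSet_eq_two hC.connected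
    (hC.2 ▸ ncard_neighborSet_cycleGraph hC.1), Fintype.card_fin]

section Cycle

open scoped Fin.CommRing

variable {k : ℕ} {C : SignedGraph (Fin (k + 3))}

theorem IsSignedCycle.adj_iff (hC : C.IsSignedCycle) {u v : Fin (k + 3)} :
    C.graph.Adj u v ↔ v = u + 1 ∨ u = v + 1 := by
  rw [hC.2, SimpleGraph.cycleGraph_adj, sub_eq_iff_eq_add', sub_eq_iff_eq_add', or_comm]

theorem IsSignedCycle.adj_natCast (hC : C.IsSignedCycle) (i : ℕ) :
    C.graph.Adj (i : Fin (k + 3)) ((i + 1 : ℕ) : Fin (k + 3)) :=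
  hC.adj_iff.2 (.inl (Nat.cast_succ i))

/-- The sign of the edge from `i` to `i + 1` of a signed cycle, with `i` read modulo the length. -/
def IsSignedCycle.edgeSign (hC : C.IsSignedCycle) (i : ℕ) : ℤˣ :=
  C.sign i (i + 1 : ℕ) (hC.adj_natCast i)

/-- The product of the first `l` edge signs of a signed cycle. It is a switching function of the
path obtained by unrolling the cycle, and takes the sign of the cycle at its length. -/
def IsSignedCycle.potential (hC : C.IsSignedCycle) (l : ℕ) : ℤˣ :=
  ∏ i ∈ Finset.range l, hC.edgeSign i

theorem IsSignedCycle.sign_eq_edgeSign (hC : C.IsSignedCycle) {u v : Fin (k + 3)}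
    (h : C.graph.Adj u v) {i : ℕ} (hu : u = i) (hv : v = (i + 1 : ℕ)) :
    C.sign u v h = hC.edgeSign i := by
  subst hu hv
  rfl

theorem IsSignedCycle.edgeSign_eq (hC : C.IsSignedCycle) (i : ℕ) :
    hC.edgeSign i = hC.potential i * hC.potential (i + 1) := by
  rw [potential, potential, Finset.prod_range_succ, ← mul_assoc, Int.units_mul_self, one_mul]

theorem IsSignedCycle.potential_length_add (hC : C.IsSignedCycle) (l : ℕ) :
    hC.potential (k + 3 + l) = hC.potential (k + 3) * hC.potential l := by
  have hperiodic (i : ℕ) : hC.edgeSign (k + 3 + i) = hC.edgeSign i :=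
    hC.sign_eq_edgeSign _ (by simp) (by rw [add_assoc]; simp)
  simp only [potential, Finset.prod_range_add, hperiodic]

theorem IsSignedCycle.walkSign_cycle (hC : C.IsSignedCycle) :
    C.walkSign ((SimpleGraph.cycleGraph.cycle k).mapLe hC.2.ge) = hC.potential (k + 3) := by
  have hvert {i : ℕ} (hi : i ≤ k + 3) :
      ((SimpleGraph.cycleGraph.cycle k).mapLe hC.2.ge).getVert i = (k + 3 - i : ℕ) := by
    rw [SimpleGraph.Walk.getVert_map, SimpleGraph.cycleGraph.getVert_cycle hi]
    rfl
  rw [potential, ← Finset.prod_range_reflect, walkSign_eq_prod_range _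
    (fun i => hC.edgeSign (k + 3 - 1 - i)), SimpleGraph.Walk.length_map,
    SimpleGraph.cycleGraph.length_cycle]
  intro i hi
  rw [SimpleGraph.Walk.length_map, SimpleGraph.cycleGraph.length_cycle] at hi
  rw [C.sign_comm]
  refine hC.sign_eq_edgeSign _ ?_ ?_
  · rw [hvert (by lia)]
    congr 1
    lia
  · rw [hvert (by lia)]
    congr 1
    lia

theorem IsSignedCycle.sign_eq_potential (hC : C.IsSignedCycle) (h : hC.potential (k + 3) = 1)
    (u v : Fin (k + 3)) (huv : C.graph.Adj u v) :
    C.sign u v huv = hC.potential u * hC.potential v := by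
  have hperiodic : hC.potential.Periodic (k + 3) := fun l => by
    rw [add_comm, hC.potential_length_add, h, one_mul]
  have hsucc (u : Fin (k + 3)) (h : C.graph.Adj u (u + 1)) :
      C.sign u (u + 1) h = hC.potential u * hC.potential (u + 1 : Fin (k + 3)) := by
    have hval : ((u + 1 : Fin (k + 3)) : ℕ) = (u + 1 : ℕ) % (k + 3) := by simp [Fin.val_add]
    rw [hval, hperiodic.map_mod_nat, ← hC.edgeSign_eq]
    exact hC.sign_eq_edgeSign _ (by simp) (by simp)
  rcases hC.adj_iff.1 huv with rfl | rfl
  · exact hsucc u huv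
  · rw [C.sign_comm, hsucc v huv.symm, mul_comm]

theorem IsSignedCycle.balanced_iff (hC : C.IsSignedCycle) :
    C.Balanced ↔ hC.potential (k + 3) = 1 := by
  refine ⟨fun h => ?_, fun h v w _ => ?_⟩
  · rw [← hC.walkSign_cycle]
    exact h 0 _ (SimpleGraph.cycleGraph.isCycle_cycle.mapLe _)
  · rw [walkSign_eq_of_potential (hC.sign_eq_potential h), Int.units_mul_self]

theorem IsSignedCycle.adjMatrix_mulVec_natCast (hC : C.IsSignedCycle) (x : Fin (k + 3) → ℝ)
    (i : ℕ) :
    (C.adjMatrix *ᵥ x) (i + 1 : ℕ) = (hC.potential (i + 1) : ℤ) *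
      ((hC.potential (i + 2) : ℤ) * x (i + 2 : ℕ) + (hC.potential i : ℤ) * x i) := by
  have hne : ((i + 2 : ℕ) : Fin (k + 3)) ≠ (i : ℕ) := by
    rw [Nat.cast_add, Ne, add_eq_left]
    exact ne_of_beq_false rfl
  have hnext : C.adjMatrix (i + 1 : ℕ) (i + 2 : ℕ) = (hC.edgeSign (i + 1) : ℤ) :=
    dif_pos (hC.adj_natCast (i + 1))
  have hprev : C.adjMatrix (i + 1 : ℕ) (i : ℕ) = (hC.edgeSign i : ℤ) := by
    rw [← C.isHermitian_adjMatrix.apply]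
    exact congrArg star (dif_pos (hC.adj_natCast i))
  rw [mulVec, dotProduct, Finset.sum_eq_add _ _ hne, hnext, hprev, hC.edgeSign_eq, hC.edgeSign_eq]
  · push_cast
    ring
  · rintro j - ⟨hj, hj'⟩
    have hnot : ¬ C.graph.Adj (i + 1 : ℕ) j := by
      rw [hC.adj_iff, ← Nat.cast_succ, Nat.cast_succ i, add_left_inj]
      exact fun h => h.elim hj fun h => hj' h.symm
    rw [not_not.1 (mt C.adjMatrix_apply_ne_zero_iff.1 hnot), zero_mul]
  · simp
  · simp

theorem IsSignedCycle.adjMatrix_mulVec_eq_zero_iff (hC : C.IsSignedCycle)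
    (x : Fin (k + 3) → ℝ) :
    C.adjMatrix *ᵥ x = 0 ↔ ∀ i : ℕ,
      ((hC.potential (i + 2) : ℤ) * x (i + 2 : ℕ) : ℝ) = -((hC.potential i : ℤ) * x i) := by
  have hcast (i : ℕ) : ((hC.potential i : ℤ) : ℝ) ≠ 0 := by simp
  simp only [eq_neg_iff_add_eq_zero]
  refine ⟨fun h i => ?_, fun h => funext fun j => ?_⟩
  · have hrow := hC.adjMatrix_mulVec_natCast x i
    rw [h, Pi.zero_apply] at hrow
    exact (mul_eq_zero.1 hrow.symm).resolve_left (hcast _)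
  · have hj : j = ((j + (k + 2) + 1 : ℕ) : Fin (k + 3)) := by
      rw [add_assoc, Nat.cast_add, Fin.natCast_self, add_zero, Fin.cast_val_eq_self]
    rw [hj, hC.adjMatrix_mulVec_natCast, h, mul_zero, Pi.zero_apply]

theorem IsSignedCycle.potential_eq_of_mulVec_eq_zero (hC : C.IsSignedCycle) {p : ℕ}
    (hp : k + 3 = 2 * p) {x : Fin (k + 3) → ℝ} (hx : x ≠ 0) (hker : C.adjMatrix *ᵥ x = 0) :
    hC.potential (k + 3) = (-1) ^ p := by
  rw [hC.adjMatrix_mulVec_eq_zero_iff] at hker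
  have hiter (l q : ℕ) : ((hC.potential (2 * q + l) : ℤ) * x (2 * q + l : ℕ) : ℝ) =
      (-1) ^ q * ((hC.potential l : ℤ) * x l) := by
    induction q with
    | zero => simp
    | succ q ih =>
      rw [show 2 * (q + 1) + l = 2 * q + l + 2 by ring, hker, ih]
      ring
  obtain ⟨j, hj⟩ := Function.ne_iff.1 hx
  have hturn := hiter j p
  rw [← hp, hC.potential_length_add, Nat.cast_add, Fin.natCast_self, zero_add,
    Fin.cast_val_eq_self, Units.val_mul, Int.cast_mul, mul_assoc] at hturn
  refine Units.ext (Int.cast_injective (α := ℝ) ?_)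
  push_cast
  exact mul_right_cancel₀ (mul_ne_zero (by simp) hj) hturn

theorem IsSignedCycle.exists_mulVec_eq_zero (hC : C.IsSignedCycle) {p : ℕ}
    (hp : k + 3 = 2 * p) (hP : hC.potential (k + 3) = (-1) ^ p) :
    ∃ x, x ≠ 0 ∧ C.adjMatrix *ᵥ x = 0 := by
  let z : ℕ → ℝ := fun l => if Even l then (-1) ^ (l / 2) else 0
  have hz (l q : ℕ) : z (2 * q + l) = (-1) ^ q * z l := by
    have hdiv : (2 * q + l) / 2 = q + l / 2 := by lia
    simp [z, hdiv, pow_add, Nat.even_add]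
  let y : ℕ → ℝ := fun l => (hC.potential l : ℤ) * z l
  have hperiodic : y.Periodic (k + 3) := fun l => by
    have hshift : z (k + 3 + l) = (-1) ^ p * z l := hp ▸ hz l p
    simp only [y, add_comm l, hC.potential_length_add, hP, hshift]
    push_cast
    rw [mul_mul_mul_comm, ← mul_pow]
    norm_num
  refine ⟨fun j => y j, fun h => ?_, (hC.adjMatrix_mulVec_eq_zero_iff _).2 fun i => ?_⟩
  · simpa [y, z] using congrFun h 0
  · have hsq (l : ℕ) : ((hC.potential l : ℤ) : ℝ) * (hC.potential l : ℤ) = 1 := by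
      rw [← Int.cast_mul, ← Units.val_mul, Int.units_mul_self, Units.val_one, Int.cast_one]
    simp only [Fin.val_natCast, hperiodic.map_mod_nat]
    rw [← mul_assoc, ← mul_assoc, hsq, hsq, add_comm i 2, ← mul_one 2, hz]
    ring

theorem IsSignedCycle.ker_ne_bot_iff (hC : C.IsSignedCycle) {p : ℕ} (hp : k + 3 = 2 * p) :
    LinearMap.ker C.adjMatrix.mulVecLin ≠ ⊥ ↔ hC.potential (k + 3) = (-1) ^ p := by
  rw [Submodule.ne_bot_iff]
  refine ⟨fun ⟨x, hker, hx⟩ => hC.potential_eq_of_mulVec_eq_zero hp hx hker, fun hP => ?_⟩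
  obtain ⟨x, hx, hker⟩ := hC.exists_mulVec_eq_zero hp hP
  exact ⟨x, hker, hx⟩

theorem IsSignedCycle.excess_eq_zero_iff_potential (hC : C.IsSignedCycle) {p : ℕ}
    (hp : k + 3 = 2 * p) : C.excess = 0 ↔ hC.potential (k + 3) = (-1) ^ p := by
  have hcoloring : C.graph.Coloring Bool :=
    hC.2 ▸ SimpleGraph.cycleGraph.bicoloring_of_even _ (hp ▸ even_two_mul p)
  have hrank := two_mul_negInertia_add_finrank_ker hcoloring
  have hexcess := hC.excess_eq
  have hnonneg : 0 ≤ C.excess := (C.excessBound hC.connected inferInstance).1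
  rw [← hC.ker_ne_bot_iff hp, ← Submodule.one_le_finrank_iff]
  rw [Fintype.card_fin] at hrank
  lia

end Cycle

theorem IsSignedCycle.excess_eq_zero_iff {n : ℕ} {C : SignedGraph (Fin n)}
    (hC : C.IsSignedCycle) : C.excess = 0 ↔
      (C.Balanced → n ≡ 0 [MOD 4]) ∧ (¬ C.Balanced → n ≡ 2 [MOD 4]) := by
  obtain ⟨k, rfl⟩ := Nat.exists_eq_add_of_le' hC.1
  rcases Nat.even_or_odd' (k + 3) with ⟨p, hp | hp⟩
  · rw [hC.excess_eq_zero_iff_potential hp, hC.balanced_iff]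
    rcases Nat.even_or_odd p with heven | hodd
    · have hmod : k + 3 ≡ 0 [MOD 4] ∧ ¬ k + 3 ≡ 2 [MOD 4] := by
        obtain ⟨q, hq⟩ := heven
        constructor <;> unfold Nat.ModEq <;> lia
      rw [heven.neg_one_pow]
      tauto
    · have hmod : ¬ k + 3 ≡ 0 [MOD 4] ∧ k + 3 ≡ 2 [MOD 4] := by
        obtain ⟨q, hq⟩ := hodd
        constructor <;> unfold Nat.ModEq <;> lia
      rw [hodd.neg_one_pow, ← Int.units_ne_iff_eq_neg]
      tauto
  · have hexcess := hC.excess_eq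
    have hmod : ¬ k + 3 ≡ 0 [MOD 4] ∧ ¬ k + 3 ≡ 2 [MOD 4] := by
      constructor <;> unfold Nat.ModEq <;> lia
    have hne : C.excess ≠ 0 := by lia
    tauto

section Congr

variable {ι κ X : Type*} {A : ι → Type*} {B : κ → Type*}

/-- The composition of two isomorphisms of signed graphs. -/
def Iso.trans {Γ : SignedGraph V} {Δ : SignedGraph W} {Θ : SignedGraph X} (e : Γ.Iso Δ)
    (f : Δ.Iso Θ) : Γ.Iso Θ where
  toGraphIso := e.toGraphIso.trans f.toGraphIso
  sign_eq u v h := (f.sign_eq _ _ _).trans (e.sign_eq u v h)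

/-- A bijection of the index sets together with isomorphisms of the members of two families of
signed graphs, as an isomorphism of their disjoint unions. -/
def disjointUnionCongr {Γ : ∀ i, SignedGraph (A i)} {Δ : ∀ j, SignedGraph (B j)} (g : ι ≃ κ)
    (e : ∀ i, (Γ i).Iso (Δ (g i))) : (disjointUnion Γ).Iso (disjointUnion Δ) where
  toGraphIso :=
    { toEquiv := Equiv.sigmaCongr g fun i => (e i).toGraphIso.toEquiv
      map_rel_iff' := by
        rintro ⟨i, u⟩ ⟨j, v⟩
        refine ⟨fun ⟨h, hadj⟩ => ?_, fun ⟨h, hadj⟩ => ?_⟩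
        · obtain rfl : i = j := g.injective h
          exact ⟨rfl, (e i).toGraphIso.map_rel_iff.1 hadj⟩
        · cases h
          exact ⟨rfl, (e i).toGraphIso.map_rel_iff.2 hadj⟩ }
  sign_eq := by
    rintro ⟨i, u⟩ ⟨_, v⟩ ⟨h, hadj⟩
    cases h
    exact (e i).sign_eq u v hadj

end Congr

theorem excess_disjointUnion_eq_zero_iff {ι : Type*} [Fintype ι] {W : ι → Type*}
    [∀ i, Fintype (W i)] [∀ i, Nontrivial (W i)] {C : ∀ i, SignedGraph (W i)}
    (hC : ∀ i, (C i).graph.Connected) :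
    (disjointUnion C).excess = 0 ↔ ∀ i, (C i).excess = 0 := by
  rw [excess_disjointUnion C hC, Finset.sum_eq_zero_iff_of_nonneg fun i _ =>
    ((C i).excessBound (hC i) inferInstance).1]
  simp

section ExcessZero

variable [Fintype V] {Γ : SignedGraph V}

theorem exists_iso_isSignedCycle [Nontrivial V] (h : Γ.graph.Connected) (hΓ : Γ.excess = 0) :
    ∃ (m : ℕ) (C : SignedGraph (Fin m)), C.IsSignedCycle ∧ Nonempty (Γ.Iso C) := by
  classical
  have hdeg (v : V) : (Γ.graph.neighborSet v).ncard = 2 := by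
    by_contra hv
    rw [ncard_neighborSet] at hv
    have hpos : 1 ≤ Γ.excess := (Γ.excessBound h inferInstance).2 ⟨v, by convert hv⟩
    lia
  obtain ⟨m, hm, ⟨f⟩⟩ := exists_iso_cycleGraph h hdeg
  exact ⟨m, Γ.comap f, ⟨hm, by ext u v; exact f.map_rel_iff⟩, ⟨(isoComap Γ f.toEquiv).symm⟩⟩

theorem exists_iso_disjointUnion_isSignedCycle
    (hcomp : ∀ c : Γ.graph.ConnectedComponent, 2 ≤ c.supp.ncard) (hΓ : Γ.excess = 0) :
    ∃ (t : ℕ) (m : Fin t → ℕ) (C : ∀ i, SignedGraph (Fin (m i))),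
      (∀ i, (C i).IsSignedCycle) ∧ Nonempty (Γ.Iso (disjointUnion C)) := by
  classical
  have hnontrivial (c : Γ.graph.ConnectedComponent) : Nontrivial c.supp :=
    ((Set.one_lt_ncard_iff_nontrivial).1 (hcomp c)).coe_sort
  have := Fintype.ofFinite Γ.graph.ConnectedComponent
  have hconn (c : Γ.graph.ConnectedComponent) :
      (Γ.comap (Subtype.val : c.supp → V)).graph.Connected := c.connected_toSimpleGraph
  have hexcess :=
    (excess_disjointUnion_eq_zero_iff hconn).1 (Γ.isoDisjointUnion.excess_eq.trans hΓ)
  choose m C hC e using fun c => exists_iso_isSignedCycle (hconn c) (hexcess c)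
  obtain ⟨t, ⟨g⟩⟩ := Finite.exists_equiv_fin Γ.graph.ConnectedComponent
  refine ⟨t, fun i => m (g.symm i), fun i => C (g.symm i), fun i => hC _, ⟨?_⟩⟩
  exact Γ.isoDisjointUnion.symm.trans
    (disjointUnionCongr g.symm fun i => (e (g.symm i)).some.symm).symm

end ExcessZero

end SignedGraph

theorem theorem4p2 {V : Type*} [Fintype V] (Γ : SignedGraph V) (n : ℕ)
    (hn : Fintype.card V = n)
    (hcomp : ∀ c : Γ.graph.ConnectedComponent, 2 ≤ c.supp.ncard) :
    (Γ.negInertia : ℝ) = ((n : ℝ) - (Γ.numPendant : ℝ)) / 2 - (Γ.cyclomatic : ℝ) ↔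
      ∃ (t : ℕ) (m : Fin t → ℕ) (C : ∀ i : Fin t, SignedGraph (Fin (m i))),
        (∀ i, (C i).IsSignedCycle) ∧
        ∑ i, m i = n ∧
        Nonempty (Γ.Iso (SignedGraph.disjointUnion C)) ∧
        ∀ i, ((C i).Balanced → m i ≡ 0 [MOD 4]) ∧ (¬ (C i).Balanced → m i ≡ 2 [MOD 4]) := by
  subst hn
  rw [← Γ.excess_eq_zero_iff]
  have hunion {t : ℕ} {m : Fin t → ℕ} {C : ∀ i, SignedGraph (Fin (m i))}
      (hC : ∀ i, (C i).IsSignedCycle) (e : Γ.Iso (SignedGraph.disjointUnion C)) :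
      Γ.excess = 0 ↔ ∀ i, (C i).excess = 0 := by
    have (i : Fin t) : Nontrivial (Fin (m i)) := (hC i).nontrivial
    rw [e.excess_eq, SignedGraph.excess_disjointUnion_eq_zero_iff fun i => (hC i).connected]
  constructor
  · intro hΓ
    obtain ⟨t, m, C, hC, ⟨e⟩⟩ := SignedGraph.exists_iso_disjointUnion_isSignedCycle hcomp hΓ
    have hcard : ∑ i, m i = Fintype.card V := by simp [Fintype.card_congr e.toGraphIso.toEquiv]
    exact ⟨t, m, C, hC, hcard, ⟨e⟩, fun i =>
      (hC i).excess_eq_zero_iff.1 ((hunion hC e).1 hΓ i)⟩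
  · rintro ⟨t, m, C, hC, -, ⟨e⟩, hmod⟩
    exact (hunion hC e).2 fun i => (hC i).excess_eq_zero_iff.2 (hmod i)
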